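/- Let $R$ be a commutative ring with $1$ and let $u,x\in R$ (for instance, $u,x$ may be numbers or indeterminates). Let $M_n(u)\in R$, $n\ge 0$, be the coefficients of the unique formal power series $f(z)=\sum_{n\ge 0}M_n(u)z^n$ that satisfies $f(z)=1+u\,z\,f(z)+z^2f(z)^2$; for $u=1$ these are the Motzkin numbers. Let $F_n(y,s)$ be the bivariate Fibonacci polynomials, defined by $F_0(y,s)=0$, $F_1(y,s)=1$ and $F_n(y,s)=y\,F_{n-1}(y,s)+s\,F_{n-2}(y,s)$ for $n\ge 2$. Then for every integer $n\ge 0$ $$\det\bigl(M_{i+j}(u)+M_{i+j+1}(u)\bigr)_{i,j=0}^{n}=F_{n+2}(u+1,-1),$$ $$\det\bigl(M_{i+j+1}(u)\bigr)_{i,j=0}^{n}=F_{n+2}(u,-1),$$ $$\det\bigl(x\,M_{i+j+1}(u)-M_{i+j+2}(u)\bigr)_{i,j=0}^{n}=\sum_{k=0}^{n+1}(-1)^{n+1-k}F_{k+1}(u,-1)\,F_{k+1}(x-u,-1).$$ There is no restriction on $u$; in particular the identities hold for $u=1$. -/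

import Mathlib

/-- The bivariate Fibonacci polynomials, evaluated in a commutative ring:
`F 0 = 0`, `F 1 = 1`, `F (n + 2) = x * F (n + 1) + s * F n`. -/
def bivariateFib {R : Type*} [CommRing R] (x s : R) : ℕ → R
  | 0 => 0
  | 1 => 1
  | n + 2 => x * bivariateFib x s (n + 1) + s * bivariateFib x s n

/-- The Motzkin-type numbers `M n = M_n(u)`, the coefficients of the formal power series `f` with
`f = 1 + u z f + z ^ 2 f ^ 2`. Comparing coefficients, this equation is the recursion below; see
`motzkinNum_genFun` and `eq_motzkinNum_of_genFun`. -/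
def motzkinNum {R : Type*} [CommRing R] (u : R) : ℕ → R
  | 0 => 1
  | 1 => u
  | n + 2 => u * motzkinNum u (n + 1) +
      ∑ i : Fin (n + 1), motzkinNum u i * motzkinNum u (n - i)
  decreasing_by all_goals omega

/-- A sequence satisfies the functional equation `f = 1 + u z f + z ^ 2 f ^ 2` exactly when it
satisfies the recursion. -/
theorem genFun_iff_recursion {R : Type*} [CommRing R] (u : R) (a : ℕ → R) :
    (PowerSeries.mk a = 1 + PowerSeries.C u * PowerSeries.X * PowerSeries.mk a
        + PowerSeries.X ^ 2 * PowerSeries.mk a ^ 2) ↔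
      a 0 = 1 ∧ a 1 = u * a 0 ∧
        ∀ n, a (n + 2) = u * a (n + 1) + ∑ i : Fin (n + 1), a i * a (n - i) := by
  have key : ∀ n, PowerSeries.coeff n (1 + PowerSeries.C u * PowerSeries.X * PowerSeries.mk a
        + PowerSeries.X ^ 2 * PowerSeries.mk a ^ 2) =
      match n with
      | 0 => 1
      | 1 => u * a 0
      | n + 2 => u * a (n + 1) + ∑ i : Fin (n + 1), a i * a (n - i) := by
    intro n
    have h1 : PowerSeries.C u * PowerSeries.X * PowerSeries.mk a
        = PowerSeries.C u * (PowerSeries.X * PowerSeries.mk a) := by ring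
    have h2 : (PowerSeries.X : PowerSeries R) ^ 2 * PowerSeries.mk a ^ 2
        = PowerSeries.X * (PowerSeries.X * (PowerSeries.mk a * PowerSeries.mk a)) := by ring
    rw [h1, h2]
    match n with
    | 0 => simp
    | 1 =>
      simp [PowerSeries.coeff_one, PowerSeries.coeff_C_mul, PowerSeries.coeff_succ_X_mul]
    | n + 2 =>
      rw [map_add, map_add, PowerSeries.coeff_C_mul, PowerSeries.coeff_succ_X_mul,
        PowerSeries.coeff_succ_X_mul, PowerSeries.coeff_succ_X_mul, PowerSeries.coeff_mul]
      simp only [PowerSeries.coeff_mk, PowerSeries.coeff_one]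
      rw [Finset.Nat.sum_antidiagonal_eq_sum_range_succ (fun i j => a i * a j),
        ← Fin.sum_univ_eq_sum_range (fun i => a i * a (n - i))]
      simp
  constructor
  · intro h
    have h' := fun n => (congrArg (PowerSeries.coeff n) h).trans (key n)
    simp only [PowerSeries.coeff_mk] at h'
    exact ⟨h' 0, h' 1, fun n => h' (n + 2)⟩
  · rintro ⟨h0, h1, h2⟩
    ext n
    rw [PowerSeries.coeff_mk, key n]
    match n with
    | 0 => exact h0
    | 1 => exact h1
    | n + 2 => exact h2 n

/-- The generating function of `motzkinNum u` satisfies `f = 1 + u z f + z ^ 2 f ^ 2`. -/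
theorem motzkinNum_genFun {R : Type*} [CommRing R] (u : R) :
    PowerSeries.mk (motzkinNum u) = 1 + PowerSeries.C u * PowerSeries.X
        * PowerSeries.mk (motzkinNum u) + PowerSeries.X ^ 2 * PowerSeries.mk (motzkinNum u) ^ 2 :=
  (genFun_iff_recursion u _).2
    ⟨by rw [motzkinNum], by rw [motzkinNum, motzkinNum, mul_one], fun n => by rw [motzkinNum]⟩

/-- `motzkinNum u` is the only sequence with that property. -/
theorem eq_motzkinNum_of_genFun {R : Type*} [CommRing R] (u : R) (a : ℕ → R)
    (h : PowerSeries.mk a = 1 + PowerSeries.C u * PowerSeries.X * PowerSeries.mk a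
        + PowerSeries.X ^ 2 * PowerSeries.mk a ^ 2) : a = motzkinNum u := by
  obtain ⟨h0, h1, h2⟩ := (genFun_iff_recursion u a).1 h
  funext n
  induction n using Nat.strong_induction_on with
  | _ n ih =>
    match n with
    | 0 => rw [h0, motzkinNum]
    | 1 => rw [h1, h0, motzkinNum, mul_one]
    | n + 2 =>
      rw [h2, motzkinNum, ih (n + 1) (by omega)]
      congr 1
      refine Finset.sum_congr rfl fun i _ => ?_
      rw [ih i (by omega), ih (n - i) (by omega)]

/-! Let L be the array of coefficients of z^k f^(k+1). It is unitriangular, and the functional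
equation says that shifting its rows by one is right multiplication by the tridiagonal matrix T with
u on the diagonal and 1 beside it. Hence the Hankel matrices of M_{i+j}, M_{i+j+1}, M_{i+j+2} are L
Lᵀ, L T Lᵀ and L (T² + E) Lᵀ, where E is a unit in the last corner caused by truncation
(`hankel_motzkinNum_add_two`).

As det L = 1, the determinants are those of 1 + T, T and T(x - T) - E. The first two are
continuants; the third satisfies a first-order recursion in the size
(`det_tridiagonal_mul_sub_single`). -/

/-- The coefficient of `z ^ i` in `z ^ k * f ^ (k + 1)`, where `f` is the generating function of
`motzkinNum u`. -/
noncomputable def motzkinArray {R : Type*} [CommRing R] (u : R) (i k : ℕ) : R :=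
  PowerSeries.coeff i
    (PowerSeries.X ^ k * PowerSeries.mk (motzkinNum u) ^ (k + 1) : PowerSeries R)

/-! ### Row recursion and row products of the array -/

section MotzkinArray

variable {R : Type*} [CommRing R] (u : R)

theorem motzkinArray_zero_right (i : ℕ) : motzkinArray u i 0 = motzkinNum u i := by
  simp [motzkinArray]

theorem motzkinArray_eq_zero_of_lt {i k : ℕ} (h : i < k) : motzkinArray u i k = 0 := by
  rw [motzkinArray, PowerSeries.coeff_X_pow_mul', if_neg (by omega)]

theorem motzkinArray_self (i : ℕ) : motzkinArray u i i = 1 := by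
  rw [motzkinArray, PowerSeries.coeff_X_pow_mul', if_pos le_rfl, Nat.sub_self,
    PowerSeries.coeff_zero_eq_constantCoeff_apply, map_pow,
    ← PowerSeries.coeff_zero_eq_constantCoeff_apply, PowerSeries.coeff_mk, motzkinNum, one_pow]

theorem motzkinArray_succ_zero (i : ℕ) :
    motzkinArray u (i + 1) 0 = u * motzkinArray u i 0 + motzkinArray u i 1 := by
  have h : (PowerSeries.X ^ 0 * PowerSeries.mk (motzkinNum u) ^ (0 + 1) : PowerSeries R)
      = 1 + (PowerSeries.X * (PowerSeries.C u *
          (PowerSeries.X ^ 0 * PowerSeries.mk (motzkinNum u) ^ (0 + 1)))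
        + PowerSeries.X * (PowerSeries.X ^ 1 * PowerSeries.mk (motzkinNum u) ^ (1 + 1))) := by
    linear_combination motzkinNum_genFun u
  rw [motzkinArray, h]
  simp only [map_add, PowerSeries.coeff_succ_X_mul, PowerSeries.coeff_C_mul,
    PowerSeries.coeff_one, motzkinArray]
  simp

theorem motzkinArray_succ_succ (i k : ℕ) :
    motzkinArray u (i + 1) (k + 1) =
      motzkinArray u i k + u * motzkinArray u i (k + 1) + motzkinArray u i (k + 2) := by
  have h : (PowerSeries.X ^ (k + 1) * PowerSeries.mk (motzkinNum u) ^ (k + 1 + 1) : PowerSeries R)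
      = PowerSeries.X * (PowerSeries.X ^ k * PowerSeries.mk (motzkinNum u) ^ (k + 1))
        + PowerSeries.X * (PowerSeries.C u *
          (PowerSeries.X ^ (k + 1) * PowerSeries.mk (motzkinNum u) ^ (k + 1 + 1)))
        + PowerSeries.X *
          (PowerSeries.X ^ (k + 2) * PowerSeries.mk (motzkinNum u) ^ (k + 2 + 1)) := by
    linear_combination (PowerSeries.X ^ (k + 1) * PowerSeries.mk (motzkinNum u) ^ (k + 1)) *
      motzkinNum_genFun u
  rw [motzkinArray, h]
  simp only [map_add, PowerSeries.coeff_succ_X_mul, PowerSeries.coeff_C_mul, motzkinArray]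

/-- The right side is symmetric in i and j, so a unit shift can pass from one row to the other. -/
theorem sum_motzkinArray_succ_mul (i j N : ℕ) (hi : i ≤ N) :
    ∑ k ∈ Finset.range (N + 1), motzkinArray u (i + 1) k * motzkinArray u j k =
      u * ∑ k ∈ Finset.range (N + 1), motzkinArray u i k * motzkinArray u j k +
        ∑ k ∈ Finset.range N, (motzkinArray u i k * motzkinArray u j (k + 1) +
          motzkinArray u i (k + 1) * motzkinArray u j k) := by
  have h : ∑ k ∈ Finset.range (N + 1), motzkinArray u i (k + 1) * motzkinArray u j k =
      ∑ k ∈ Finset.range N, motzkinArray u i (k + 1) * motzkinArray u j k := by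
    rw [Finset.sum_range_succ, motzkinArray_eq_zero_of_lt u (by omega : i < N + 1), zero_mul,
      add_zero]
  rw [Finset.sum_add_distrib, ← h]
  simp only [Finset.sum_range_succ' _ N, motzkinArray_succ_succ, motzkinArray_succ_zero, mul_add,
    Finset.mul_sum, add_mul, Finset.sum_add_distrib, mul_assoc]
  ring

theorem sum_motzkinArray_mul (i j N : ℕ) (h : i ≤ N ∨ j ≤ N) :
    ∑ k ∈ Finset.range (N + 1), motzkinArray u i k * motzkinArray u j k =
      motzkinNum u (i + j) := by
  have large : ∀ N i j : ℕ, i + j ≤ N →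
      ∑ k ∈ Finset.range (N + 1), motzkinArray u i k * motzkinArray u j k =
        motzkinNum u (i + j) := by
    intro N i
    induction i with
    | zero =>
      intro j _
      rw [Finset.sum_range_succ', Finset.sum_eq_zero, motzkinArray_self, motzkinArray_zero_right,
        zero_add, zero_add, one_mul]
      intro k _
      rw [motzkinArray_eq_zero_of_lt u (Nat.succ_pos k), zero_mul]
    | succ i ih =>
      intro j hN
      rw [show i + 1 + j = i + (j + 1) by omega, ← ih (j + 1) (by omega),
        sum_motzkinArray_succ_mul u i j N (by omega)]
      simp only [mul_comm (motzkinArray u i _) (motzkinArray u (j + 1) _)]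
      rw [sum_motzkinArray_succ_mul u j i N (by omega)]
      congr 1
      · simp only [mul_comm]
      · exact Finset.sum_congr rfl fun k _ => by ring
  -- The induction needs room for the shifts; the terms beyond N vanish by triangularity.
  rw [← large (N + i + j) i j (by omega)]
  refine Finset.sum_subset (Finset.range_subset_range.2 (by omega)) fun k _ hk => ?_
  rw [Finset.mem_range, not_lt] at hk
  rcases h with h | h
  · rw [motzkinArray_eq_zero_of_lt u (by omega : i < k), zero_mul]
  · rw [motzkinArray_eq_zero_of_lt u (by omega : j < k), mul_zero]

end MotzkinArray

/-! ### Tridiagonal determinants -/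

/-- The symmetric tridiagonal Toeplitz matrix with `c` on the diagonal and `e` next to it. -/
def tridiagonal {R : Type*} [CommRing R] (c e : R) (m : ℕ) : Matrix (Fin m) (Fin m) R :=
  Matrix.of fun i j => if (i : ℕ) = j then c else
    if (i : ℕ) = j + 1 ∨ (j : ℕ) = i + 1 then e else 0

section Tridiagonal

variable {R : Type*} [CommRing R]

theorem det_tridiagonal_add_two (c e : R) (m : ℕ) :
    (tridiagonal c e (m + 2)).det =
      c * (tridiagonal c e (m + 1)).det - e ^ 2 * (tridiagonal c e m).det := by
  have h0 : (tridiagonal c e (m + 2)).submatrix Fin.succ (Fin.succAbove 0) =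
      tridiagonal c e (m + 1) := by
    ext i j
    simp [tridiagonal]
  have h1 : ((tridiagonal c e (m + 2)).submatrix Fin.succ (Fin.succAbove 1)).det =
      e * (tridiagonal c e m).det := by
    rw [Matrix.det_succ_column_zero, Fin.sum_univ_succ, Finset.sum_eq_zero]
    · have h2 : (((tridiagonal c e (m + 2)).submatrix Fin.succ (Fin.succAbove 1)).submatrix
          (Fin.succAbove 0) Fin.succ) = tridiagonal c e m := by
        ext i j
        simp [tridiagonal, Fin.succAbove, Fin.lt_def]
      rw [h2]
      simp [tridiagonal]
    · intro i _
      simp [tridiagonal]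
  rw [Matrix.det_succ_row_zero, Fin.sum_univ_succ, Fin.sum_univ_succ, Finset.sum_eq_zero, h0,
    Fin.succ_zero_eq_one, h1]
  · simp [tridiagonal]
    ring
  · intro i _
    simp [tridiagonal]

theorem det_tridiagonal (c e : R) (m : ℕ) :
    (tridiagonal c e m).det = bivariateFib c (-e ^ 2) (m + 1) := by
  induction m using Nat.twoStepInduction with
  | zero => simp [bivariateFib]
  | one => simp [bivariateFib, tridiagonal]
  | more m h0 h1 =>
    have h : bivariateFib c (-e ^ 2) (m + 2 + 1) = c * bivariateFib c (-e ^ 2) (m + 1 + 1) +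
        -e ^ 2 * bivariateFib c (-e ^ 2) (m + 1) := by
      rw [bivariateFib]
    rw [det_tridiagonal_add_two, h0, h1, h]
    ring

/-- Only the last row changes, so expansion along it keeps all minors. -/
theorem det_sub_single_last {m : ℕ} (A : Matrix (Fin (m + 1)) (Fin (m + 1)) R) :
    (A - Matrix.single (Fin.last m) (Fin.last m) 1).det =
      A.det - (A.submatrix Fin.castSucc Fin.castSucc).det := by
  have h : ∀ j : Fin (m + 1), (A - Matrix.single (Fin.last m) (Fin.last m) 1).submatrix
      (Fin.last m).succAbove j.succAbove = A.submatrix (Fin.last m).succAbove j.succAbove := by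
    intro j
    ext k l
    simp [(Fin.castSucc_lt_last k).ne']
  rw [Matrix.det_succ_row _ (Fin.last m), Matrix.det_succ_row A (Fin.last m)]
  simp only [h]
  rw [Fin.sum_univ_castSucc, Fin.sum_univ_castSucc]
  simp [(Fin.castSucc_lt_last _).ne', ← two_mul, mul_sub, sub_mul,
    Fin.succAbove_last]
  ring

theorem submatrix_castSucc_mul {l m n o : Type*} {k : ℕ}
    (A : Matrix m (Fin (k + 1)) R) (B : Matrix (Fin (k + 1)) n R) (f : l → m) (g : o → n) :
    (A * B).submatrix f g = A.submatrix f Fin.castSucc * B.submatrix Fin.castSucc g +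
      Matrix.of fun i j => A (f i) (Fin.last k) * B (Fin.last k) (g j) := by
  ext i j
  simp [Matrix.mul_apply, Fin.sum_univ_castSucc]

theorem submatrix_castSucc_tridiagonal (c e : R) (m : ℕ) :
    (tridiagonal c e (m + 1)).submatrix Fin.castSucc Fin.castSucc = tridiagonal c e m := by
  ext i j
  simp [tridiagonal]

theorem det_tridiagonal_mul_sub_single (a b : R) (n : ℕ) :
    (tridiagonal a 1 (n + 1) * tridiagonal b (-1) (n + 1) -
        Matrix.single (Fin.last n) (Fin.last n) 1).det =
      ∑ k ∈ Finset.range (n + 2), (-1 : R) ^ (n + 1 - k) *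
        bivariateFib a (-1) (k + 1) * bivariateFib b (-1) (k + 1) := by
  induction n with
  | zero =>
    simp [Finset.sum_range_succ, bivariateFib, tridiagonal, Matrix.mul_apply]
    ring
  | succ n ih =>
    -- Cutting off the last index loses one term of the matrix product, the off-diagonal entries 1 ·
    -- (-1) in the new corner: the same perturbation one size down.
    have h : (tridiagonal a 1 (n + 2) * tridiagonal b (-1) (n + 2)).submatrix
        Fin.castSucc Fin.castSucc = tridiagonal a 1 (n + 1) * tridiagonal b (-1) (n + 1) -
          Matrix.single (Fin.last n) (Fin.last n) 1 := by
      rw [submatrix_castSucc_mul, submatrix_castSucc_tridiagonal, submatrix_castSucc_tridiagonal,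
        sub_eq_add_neg]
      congr 1
      ext i j
      have hi := i.isLt
      have hj := j.isLt
      simp only [tridiagonal, Matrix.of_apply, Matrix.neg_apply, Matrix.single_apply, Fin.ext_iff,
        Fin.val_castSucc, Fin.val_last]
      split_ifs <;> first | omega | simp
    rw [det_sub_single_last, h, ih, Matrix.det_mul, det_tridiagonal, det_tridiagonal,
      Finset.sum_range_succ _ (n + 2)]
    have hs : ∑ k ∈ Finset.range (n + 2), (-1 : R) ^ (n + 1 + 1 - k) *
        bivariateFib a (-1) (k + 1) * bivariateFib b (-1) (k + 1) =
        - ∑ k ∈ Finset.range (n + 2), (-1 : R) ^ (n + 1 - k) *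
        bivariateFib a (-1) (k + 1) * bivariateFib b (-1) (k + 1) := by
      rw [← Finset.sum_neg_distrib]
      refine Finset.sum_congr rfl fun k hk => ?_
      rw [Finset.mem_range] at hk
      rw [show n + 1 + 1 - k = n + 1 - k + 1 by omega, pow_succ]
      ring
    rw [hs]
    simp
    ring

end Tridiagonal

/-! ### Factoring the Hankel matrices -/

/-- The leading square block of `motzkinArray u`. -/
noncomputable def motzkinMatrix {R : Type*} [CommRing R] (u : R) (m : ℕ) :
    Matrix (Fin m) (Fin m) R :=
  Matrix.of fun i k => motzkinArray u i k

section MotzkinMatrix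

variable {R : Type*} [CommRing R] (u : R)

theorem det_motzkinMatrix (m : ℕ) : (motzkinMatrix u m).det = 1 := by
  rw [Matrix.det_of_isLowerTriangular]
  · exact Finset.prod_eq_one fun i _ => motzkinArray_self u i
  · exact fun i j hij => motzkinArray_eq_zero_of_lt u hij

theorem det_motzkinMatrix_conj {m : ℕ} (A : Matrix (Fin m) (Fin m) R) :
    (motzkinMatrix u m * A * (motzkinMatrix u m).transpose).det = A.det := by
  simp [det_motzkinMatrix]

theorem motzkinMatrix_mul_tridiagonal (n : ℕ) (i k : Fin (n + 1)) :
    (motzkinMatrix u (n + 1) * tridiagonal u 1 (n + 1)) i k = motzkinArray u (i + 1) k := by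
  obtain ⟨k, hk⟩ := k
  have hsplit : ∀ l : ℕ, motzkinArray u i l * (if l = k then u else
      if l = k + 1 ∨ k = l + 1 then 1 else 0) = (if l = k then motzkinArray u i l * u else 0) +
        (if l = k + 1 then motzkinArray u i l else 0) +
        (if k = l + 1 then motzkinArray u i l else 0) := by
    intro l
    split_ifs <;> first | omega | simp
  simp only [Matrix.mul_apply, motzkinMatrix, tridiagonal, Matrix.of_apply, hsplit]
  rw [Fin.sum_univ_eq_sum_range (fun l => (if l = k then motzkinArray u i l * u else 0) +
        (if l = k + 1 then motzkinArray u i l else 0) +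
        (if k = l + 1 then motzkinArray u i l else 0)), Finset.sum_add_distrib,
    Finset.sum_add_distrib, Finset.sum_ite_eq', Finset.sum_ite_eq', if_pos (by simpa using hk)]
  -- For k = n the neighbour k + 1 is cut off, but its entry is zero since i ≤ n.
  have h1 : (if k + 1 ∈ Finset.range (n + 1) then motzkinArray u i (k + 1) else 0) =
      motzkinArray u i (k + 1) := by
    split_ifs with h
    · rfl
    · rw [Finset.mem_range] at h
      rw [motzkinArray_eq_zero_of_lt]
      omega
  rw [h1]
  cases k with
  | zero =>
    rw [Finset.sum_eq_zero (fun l _ => if_neg (by omega)), motzkinArray_succ_zero]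
    ring
  | succ k =>
    simp only [Nat.add_right_cancel_iff]
    rw [Finset.sum_ite_eq, if_pos (by rw [Finset.mem_range]; omega), motzkinArray_succ_succ]
    ring

theorem hankel_motzkinNum (n : ℕ) :
    (Matrix.of fun i j : Fin (n + 1) => motzkinNum u ((i : ℕ) + (j : ℕ))) =
      motzkinMatrix u (n + 1) * 1 * (motzkinMatrix u (n + 1)).transpose := by
  ext i j
  rw [Matrix.mul_one, Matrix.mul_apply, Matrix.of_apply,
    ← sum_motzkinArray_mul u i j n (by omega), ← Fin.sum_univ_eq_sum_range]
  rfl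

theorem hankel_motzkinNum_succ (n : ℕ) :
    (Matrix.of fun i j : Fin (n + 1) => motzkinNum u ((i : ℕ) + (j : ℕ) + 1)) =
      motzkinMatrix u (n + 1) * tridiagonal u 1 (n + 1) *
        (motzkinMatrix u (n + 1)).transpose := by
  ext i j
  rw [Matrix.mul_apply, Matrix.of_apply, show (i : ℕ) + j + 1 = i + 1 + j by omega,
    ← sum_motzkinArray_mul u (i + 1) j n (by omega), ← Fin.sum_univ_eq_sum_range]
  simp only [motzkinMatrix_mul_tridiagonal]
  rfl

theorem tridiagonal_transpose (c e : R) (m : ℕ) :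
    (tridiagonal c e m).transpose = tridiagonal c e m := by
  ext i j
  simp only [tridiagonal, Matrix.transpose_apply, Matrix.of_apply]
  split_ifs <;> first | omega | rfl

theorem motzkinArray_succ_last (n : ℕ) (i : Fin (n + 1)) :
    motzkinArray u (i + 1) (n + 1) = motzkinArray u i n := by
  rw [motzkinArray_succ_succ, motzkinArray_eq_zero_of_lt u (by omega : (i : ℕ) < n + 1),
    motzkinArray_eq_zero_of_lt u (by omega : (i : ℕ) < n + 2), mul_zero, add_zero, add_zero]

/-- Shifted rows reach column n + 1, outside the block; that column repeats column n of the
unshifted rows, which gives the corner term. -/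
theorem hankel_motzkinNum_add_two (n : ℕ) :
    (Matrix.of fun i j : Fin (n + 1) => motzkinNum u ((i : ℕ) + (j : ℕ) + 2)) =
      motzkinMatrix u (n + 1) * (tridiagonal u 1 (n + 1) * tridiagonal u 1 (n + 1) +
        Matrix.single (Fin.last n) (Fin.last n) 1) * (motzkinMatrix u (n + 1)).transpose := by
  have hT : tridiagonal u 1 (n + 1) * (motzkinMatrix u (n + 1)).transpose =
      (motzkinMatrix u (n + 1) * tridiagonal u 1 (n + 1)).transpose := by
    rw [Matrix.transpose_mul, tridiagonal_transpose]
  rw [Matrix.mul_add, Matrix.add_mul, ← Matrix.mul_assoc, Matrix.mul_assoc _ _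
    (motzkinMatrix u (n + 1)).transpose, hT]
  ext i j
  rw [Matrix.add_apply, Matrix.mul_apply, Matrix.of_apply,
    show (i : ℕ) + j + 2 = i + 1 + (j + 1) by omega,
    ← sum_motzkinArray_mul u (i + 1) (j + 1) (n + 1) (by omega), Finset.sum_range_succ,
    ← Fin.sum_univ_eq_sum_range (fun k => motzkinArray u (i + 1) k * motzkinArray u (j + 1) k)]
  simp only [motzkinMatrix_mul_tridiagonal, Matrix.transpose_apply, motzkinArray_succ_last]
  congr 1
  rw [Matrix.mul_apply, Finset.sum_eq_single (Fin.last n)]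
  · simp [motzkinMatrix]
  · intro k _ hk
    rw [Matrix.mul_single_apply_of_ne _ _ _ _ _ hk, zero_mul]
  · simp

end MotzkinMatrix

theorem mainTheorem12 {R : Type*} [CommRing R] (u x : R) (n : ℕ) :
    (Matrix.of fun i j : Fin (n + 1) =>
        motzkinNum u ((i : ℕ) + (j : ℕ)) + motzkinNum u ((i : ℕ) + (j : ℕ) + 1)).det
      = bivariateFib (u + 1) (-1) (n + 2) ∧
    (Matrix.of fun i j : Fin (n + 1) => motzkinNum u ((i : ℕ) + (j : ℕ) + 1)).det
      = bivariateFib u (-1) (n + 2) ∧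
    (Matrix.of fun i j : Fin (n + 1) =>
        x * motzkinNum u ((i : ℕ) + (j : ℕ) + 1) - motzkinNum u ((i : ℕ) + (j : ℕ) + 2)).det
      = ∑ k ∈ Finset.range (n + 2), (-1 : R) ^ (n + 1 - k) *
          bivariateFib u (-1) (k + 1) * bivariateFib (x - u) (-1) (k + 1) := by
  refine ⟨?_, ?_, ?_⟩
  · have h : (1 : Matrix (Fin (n + 1)) (Fin (n + 1)) R) + tridiagonal u 1 (n + 1) =
        tridiagonal (u + 1) 1 (n + 1) := by
      ext i j
      simp only [tridiagonal, Matrix.add_apply, Matrix.one_apply, Matrix.of_apply, Fin.ext_iff]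
      split_ifs <;> ring
    have h' := congrArg₂ (· + ·) (hankel_motzkinNum u n) (hankel_motzkinNum_succ u n)
    simp only [← Matrix.add_mul, ← Matrix.mul_add, h, Matrix.of_add_of] at h'
    refine (congrArg Matrix.det h').trans ?_
    rw [det_motzkinMatrix_conj, det_tridiagonal, one_pow]
  · rw [hankel_motzkinNum_succ, det_motzkinMatrix_conj, det_tridiagonal, one_pow]
  · have h : x • (1 : Matrix (Fin (n + 1)) (Fin (n + 1)) R) - tridiagonal u 1 (n + 1) =
        tridiagonal (x - u) (-1) (n + 1) := by
      ext i j
      simp only [tridiagonal, Matrix.sub_apply, Matrix.smul_apply, Matrix.one_apply,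
        Matrix.of_apply, Fin.ext_iff, smul_eq_mul]
      split_ifs <;> ring
    have h' := congrArg₂ (fun A B => x • A - B) (hankel_motzkinNum_succ u n)
      (hankel_motzkinNum_add_two u n)
    rw [← Matrix.smul_mul, ← Matrix.mul_smul, ← Matrix.sub_mul, ← Matrix.mul_sub] at h'
    refine (congrArg Matrix.det h').trans ?_
    rw [det_motzkinMatrix_conj, ← det_tridiagonal_mul_sub_single, ← h, Matrix.mul_sub,
      Matrix.mul_smul, Matrix.mul_one, sub_add_eq_sub_sub]
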